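/- For an integer $q\ge 2$ let $$f(x|q)=\frac{\Gamma(q/2)}{\Gamma(1/2)\,\Gamma((q-1)/2)}\,(1-x^2)^{(q-3)/2}\quad(|x|<1),\qquad f(x|q)=0\quad(|x|\ge 1),$$ where $\Gamma(\cdot)$ is the gamma function, and let $\nu_q$ be the probability measure on $\mathbb R$ with density $f(\cdot|q)$ with respect to Lebesgue measure. Let $\nu_1$ be the uniform distribution on $\{-1,1\}$. **Theorem 3.4.** Let $p\ge 3$ be an integer, let $\Gamma$ be a random matrix with the Haar (uniform) distribution on the group $\mathcal O_p$ of real orthogonal $p\times p$ matrices, let $x_0=(1,0,\dots,0)'\in\mathbb R^p$, and put $U_3=x_0'\,\Gamma^3x_0$. Let $\xi_1,\xi_2,\xi_3$ be mutually independent real random variables such that $\xi_i$ has law $\nu_{p+1-i}$ for $i=1,2,3$ (that is, $\xi_i$ has density $f(\cdot|p+1-i)$, except that for $p=3$ the variable $\xi_3$ is uniformly distributed on $\{-1,1\}$). Then $U_3$ has the same law as $$\xi_1^3+2\xi_1(1-\xi_1^2)\,\xi_2+(1-\xi_1^2)\bigl[-\xi_1\xi_2^2+(1-\xi_2^2)\,\xi_3\bigr].$$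 -/

import Mathlib

open MeasureTheory ProbabilityTheory Matrix

noncomputable section

/-- The function `f(x|q) = Γ(q/2) / (Γ(1/2) Γ((q-1)/2)) * (1 - x²)^((q-3)/2)` for `|x| < 1`,
extended by zero. It is a probability density on the line for every integer `q ≥ 2`. -/
def coordDensity (q : ℕ) (x : ℝ) : ℝ :=
  if |x| < 1 then
    Real.Gamma ((q : ℝ) / 2) / (Real.Gamma (1 / 2) * Real.Gamma (((q : ℝ) - 1) / 2)) *
      (1 - x ^ 2) ^ (((q : ℝ) - 3) / 2)
  else 0

/-- The probability law on the line denoted by `f(·|q)`. For `q ≥ 2` it has density `f(·|q)` with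
respect to Lebesgue measure. For `q = 1` there is no density: the law is the uniform distribution
on `{-1, 1}` (the Haar distribution on the orthogonal group `{-1, 1}` of `1 × 1` matrices). -/
def coordLaw (q : ℕ) : Measure ℝ :=
  if q = 1 then (2⁻¹ : ENNReal) • (Measure.dirac 1 + Measure.dirac (-1))
  else volume.withDensity (fun x => ENNReal.ofReal (coordDensity q x))

/-- The north pole `x₀ = (1, 0, …, 0)'` in `ℝ^p`. -/
def northPole (p : ℕ) : Fin p → ℝ := fun i => if (i : ℕ) = 0 then 1 else 0

/-- `x₀' g^k x₀` for an orthogonal matrix `g`. -/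
def northPoleStat (p k : ℕ) (g : Matrix.orthogonalGroup (Fin p) ℝ) : ℝ :=
  northPole p ⬝ᵥ (((g : Matrix (Fin p) (Fin p) ℝ) ^ k) *ᵥ northPole p)

/-- The Borel σ-algebra on the orthogonal group. -/
instance orthogonalGroupMeasurableSpace (p : ℕ) :
    MeasurableSpace (Matrix.orthogonalGroup (Fin p) ℝ) := borel _

instance orthogonalGroupBorelSpace (p : ℕ) :
    BorelSpace (Matrix.orthogonalGroup (Fin p) ℝ) := ⟨rfl⟩

/-- A random orthogonal matrix `Γ`, on a space with measure `P`, has the Haar distribution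
if its law is a Haar measure on the orthogonal group (it is then the normalized one whenever `P`
is a probability measure). -/
structure IsHaarDistributed {Ω : Type*} [MeasurableSpace Ω] {p : ℕ}
    (Γ : Ω → Matrix.orthogonalGroup (Fin p) ℝ) (P : Measure Ω) : Prop where
  aemeasurable : AEMeasurable Γ P
  isHaarMeasure_map : (P.map Γ).IsHaarMeasure

end

/-!
The law of the corner entry of `g³`, for `g` Haar distributed in `O(p)`.

Write `y = (t, z)` for the first column of `g`, and let `H` be the reflection which exchanges the
north pole and `y`. Then `g = H diag(1, D)` with `D ∈ O(p - 1)`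
(`exists_eq_poleReflectionUnit_mul`), and the corners of `g`, `g²`, `g³` are explicit functions of
`t`, `z'Dz` and `z'D²z` (`corner_pow_poleReflection_mul`). As the Haar measure is invariant under
right multiplication by `diag(1, D)`, the matrix `D` may be taken Haar distributed and independent
of `y`; as its law is invariant under conjugation and `O(p - 1)` is transitive on spheres, `z` may
then be replaced by `√(1 - t²)` times the north pole. Hence the corners of the first three powers
in dimension `p` are functions of an independent corner `t` and of the corners of the first *two*
powers in dimension `p - 1` (`lintegral_cornerTriple`). Two applications of this recursion express
the corner of `g³` through three independent corners, in dimensions `p`, `p - 1`, `p - 2`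
(`lintegral_northPoleStat_three`).

It remains to find the law of one corner. In dimension one it is a random sign. In dimension
`q ≥ 2` it is the law of the first coordinate of `x / |x|` for `x` uniform in the unit ball
(`lintegral_radial_mul`), and a substitution followed by a dilation of the other coordinates shows
that it has a density proportional to `(1 - t²)^((q - 3) / 2)`
(`lintegral_radial_mul_eq_lintegral_Ioo`).

Laws are compared through the integrals of all measurable functions with values in `[0, ∞]`.
-/

/-! ### The orthogonal group as a compact group -/

instance secondCountableTopology_orthogonalGroup (n : ℕ) :
    SecondCountableTopology (orthogonalGroup (Fin n) ℝ) := by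
  have : SecondCountableTopology (Matrix (Fin n) (Fin n) ℝ) :=
    inferInstanceAs (SecondCountableTopology (Fin n → Fin n → ℝ))
  exact TopologicalSpace.Subtype.secondCountableTopology _

instance compactSpace_orthogonalGroup (n : ℕ) : CompactSpace (orthogonalGroup (Fin n) ℝ) := by
  have hcube : IsCompact (Set.univ.pi fun _ : Fin n => Set.univ.pi fun _ : Fin n =>
      Set.Icc (-1 : ℝ) 1) :=
    isCompact_univ_pi fun _ => isCompact_univ_pi fun _ => isCompact_Icc
  have hclosed : IsClosed {A : Matrix (Fin n) (Fin n) ℝ | A * Aᵀ = 1} :=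
    isClosed_eq (continuous_id.matrix_mul continuous_id.matrix_transpose) continuous_const
  have hcompact : IsCompact {A : Matrix (Fin n) (Fin n) ℝ | A * Aᵀ = 1} := by
    refine IsCompact.of_isClosed_subset hcube hclosed fun A hA => ?_
    have hA' : A ∈ orthogonalGroup (Fin n) ℝ := (mem_orthogonalGroup_iff _ _).2 hA
    exact fun i _ j _ => abs_le.1 (entry_norm_bound_of_unitary hA' i j)
  have hset : (orthogonalGroup (Fin n) ℝ : Set (Matrix (Fin n) (Fin n) ℝ)) = {A | A * Aᵀ = 1} :=
    Set.ext fun A => mem_orthogonalGroup_iff _ _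
  exact isCompact_iff_compactSpace.1 (hset ▸ hcompact)

/-! ### The stabilizer of the north pole -/

/-- The block matrix `diag(1, A)`. -/
def blockOne {n : ℕ} (A : Matrix (Fin n) (Fin n) ℝ) : Matrix (Fin (n + 1)) (Fin (n + 1)) ℝ :=
  of (vecCons (vecCons 1 0) fun i => vecCons 0 (A i))

lemma blockOne_mul {n : ℕ} (A B : Matrix (Fin n) (Fin n) ℝ) :
    blockOne A * blockOne B = blockOne (A * B) := by
  ext i j
  refine Fin.cases ?_ (fun i => ?_) i <;> refine Fin.cases ?_ (fun j => ?_) j <;>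
    simp [blockOne, mul_apply, Fin.sum_univ_succ]

lemma blockOne_one {n : ℕ} : blockOne (1 : Matrix (Fin n) (Fin n) ℝ) = 1 := by
  ext i j
  refine Fin.cases ?_ (fun i => ?_) i <;> refine Fin.cases ?_ (fun j => ?_) j <;>
    simp [blockOne, one_apply, Fin.succ_ne_zero, (Fin.succ_ne_zero _).symm]

lemma transpose_blockOne {n : ℕ} (A : Matrix (Fin n) (Fin n) ℝ) :
    (blockOne A)ᵀ = blockOne Aᵀ := by
  ext i j
  refine Fin.cases ?_ (fun i => ?_) i <;> refine Fin.cases ?_ (fun j => ?_) j <;>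
    simp [blockOne]

lemma blockOne_mulVec {n : ℕ} (A : Matrix (Fin n) (Fin n) ℝ) (a : ℝ) (v : Fin n → ℝ) :
    blockOne A *ᵥ vecCons a v = vecCons a (A *ᵥ v) := by
  ext i
  refine Fin.cases ?_ (fun i => ?_) i <;> simp [blockOne, mulVec, dotProduct, Fin.sum_univ_succ]

lemma continuous_blockOne {n : ℕ} : Continuous (blockOne (n := n)) := by
  refine continuous_matrix fun i j => ?_
  refine Fin.cases ?_ (fun i => ?_) i <;> refine Fin.cases ?_ (fun j => ?_) j <;>
    simp only [blockOne, of_apply, cons_val_zero, cons_val_succ]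
  · exact continuous_const
  · exact continuous_const
  · exact continuous_const
  · exact continuous_id.matrix_elem i j

/-- The embedding `k ↦ diag(1, k)` of `O(n)` into `O(n + 1)`, whose image is the stabilizer of the
north pole. -/
def stabilizerEmb {n : ℕ} (k : orthogonalGroup (Fin n) ℝ) : orthogonalGroup (Fin (n + 1)) ℝ :=
  ⟨blockOne k, (mem_orthogonalGroup_iff _ _).2 <| by
    rw [transpose_blockOne, blockOne_mul, (mem_orthogonalGroup_iff _ _).1 k.2, blockOne_one]⟩

lemma stabilizerEmb_mul {n : ℕ} (k l : orthogonalGroup (Fin n) ℝ) :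
    stabilizerEmb (k * l) = stabilizerEmb k * stabilizerEmb l :=
  Subtype.ext (blockOne_mul _ _).symm

lemma continuous_stabilizerEmb {n : ℕ} : Continuous (stabilizerEmb (n := n)) :=
  (continuous_blockOne.comp continuous_subtype_val).subtype_mk _

lemma northPole_succ (n : ℕ) : northPole (n + 1) = vecCons 1 0 := by
  ext i
  refine Fin.cases ?_ (fun i => ?_) i <;> simp [northPole]

lemma northPole_eq_single (n : ℕ) : northPole (n + 1) = Pi.single 0 1 := by
  ext i
  refine Fin.cases ?_ (fun i => ?_) i <;> simp [northPole]

lemma mulVec_northPole {n : ℕ} (A : Matrix (Fin (n + 1)) (Fin (n + 1)) ℝ) :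
    A *ᵥ northPole (n + 1) = fun i => A i 0 := by
  rw [northPole_eq_single]
  ext i
  simp

lemma northPole_dotProduct {n : ℕ} (v : Fin (n + 1) → ℝ) : northPole (n + 1) ⬝ᵥ v = v 0 := by
  rw [northPole_eq_single]
  simp

lemma northPoleStat_succ {n : ℕ} (k : ℕ) (g : orthogonalGroup (Fin (n + 1)) ℝ) :
    northPoleStat (n + 1) k g = ((g : Matrix (Fin (n + 1)) (Fin (n + 1)) ℝ) ^ k) 0 0 := by
  rw [northPoleStat, northPole_dotProduct, mulVec_northPole]

lemma transpose_mul_self_orthogonalGroup {n : ℕ} (g : orthogonalGroup (Fin n) ℝ) :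
    (g : Matrix (Fin n) (Fin n) ℝ)ᵀ * g = 1 :=
  (mem_orthogonalGroup_iff' _ _).1 g.2

lemma mul_transpose_self_orthogonalGroup {n : ℕ} (g : orthogonalGroup (Fin n) ℝ) :
    (g : Matrix (Fin n) (Fin n) ℝ) * (g : Matrix (Fin n) (Fin n) ℝ)ᵀ = 1 :=
  (mem_orthogonalGroup_iff _ _).1 g.2

lemma coe_inv_orthogonalGroup {n : ℕ} (g : orthogonalGroup (Fin n) ℝ) :
    ((g⁻¹ : orthogonalGroup (Fin n) ℝ) : Matrix (Fin n) (Fin n) ℝ)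
      = (g : Matrix (Fin n) (Fin n) ℝ)ᵀ := by
  change star (g : Matrix (Fin n) (Fin n) ℝ) = _
  rw [star_eq_conjTranspose, conjTranspose_eq_transpose_of_trivial]

lemma dotProduct_mulVec_orthogonalGroup {n : ℕ} (g : orthogonalGroup (Fin n) ℝ)
    (v w : Fin n → ℝ) :
    ((g : Matrix (Fin n) (Fin n) ℝ) *ᵥ v) ⬝ᵥ ((g : Matrix (Fin n) (Fin n) ℝ) *ᵥ w) = v ⬝ᵥ w := by
  rw [dotProduct_mulVec, vecMul_mulVec, transpose_mul_self_orthogonalGroup, vecMul_one]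

lemma exists_eq_stabilizerEmb {n : ℕ} (g : orthogonalGroup (Fin (n + 1)) ℝ)
    (hg : (g : Matrix (Fin (n + 1)) (Fin (n + 1)) ℝ) *ᵥ northPole (n + 1) = northPole (n + 1)) :
    ∃ k, g = stabilizerEmb k := by
  set A : Matrix (Fin (n + 1)) (Fin (n + 1)) ℝ := g.1 with hA
  have hgt : Aᵀ *ᵥ northPole (n + 1) = northPole (n + 1) := by
    conv_lhs => rw [← hg]
    rw [mulVec_mulVec, transpose_mul_self_orthogonalGroup, one_mulVec]
  have hcol : ∀ i : Fin n, A i.succ 0 = 0 := fun i => by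
    simpa [mulVec_northPole, northPole] using congrFun hg i.succ
  have hrow : ∀ i : Fin n, A 0 i.succ = 0 := fun i => by
    simpa [mulVec_northPole, northPole] using congrFun hgt i.succ
  have hone : A 0 0 = 1 := by simpa [mulVec_northPole, northPole] using congrFun hg 0
  have hblock : A = blockOne (A.submatrix Fin.succ Fin.succ) := by
    ext i j
    refine Fin.cases ?_ (fun i => ?_) i <;> refine Fin.cases ?_ (fun j => ?_) j <;>
      simp [blockOne, hcol, hrow, hone]
  refine ⟨⟨A.submatrix Fin.succ Fin.succ, (mem_orthogonalGroup_iff _ _).2 ?_⟩, Subtype.ext hblock⟩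
  ext i j
  have h := congrFun (congrFun (mul_transpose_self_orthogonalGroup g) i.succ) j.succ
  rw [← hA] at h
  simpa [mul_apply, Fin.sum_univ_succ, hcol, one_apply] using h

/-! ### Reflections -/

/-- The reflection exchanging the north pole and the unit vector `y`. When `y` is the north pole
the factor `(1 - y 0)⁻¹` is zero, and the matrix is the identity, as it should be. -/
noncomputable def poleReflection {n : ℕ} (y : Fin (n + 1) → ℝ) :
    Matrix (Fin (n + 1)) (Fin (n + 1)) ℝ :=
  1 - (1 - y 0)⁻¹ • vecMulVec (northPole (n + 1) - y) (northPole (n + 1) - y)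

lemma transpose_poleReflection {n : ℕ} (y : Fin (n + 1) → ℝ) :
    (poleReflection y)ᵀ = poleReflection y := by
  simp [poleReflection, transpose_vecMulVec]

lemma poleReflection_mulVec {n : ℕ} (y v : Fin (n + 1) → ℝ) :
    poleReflection y *ᵥ v = v - ((1 - y 0)⁻¹ * (v 0 - y ⬝ᵥ v)) • (northPole (n + 1) - y) := by
  rw [poleReflection, sub_mulVec, one_mulVec, smul_mulVec, vecMulVec_mulVec, sub_dotProduct,
    northPole_dotProduct]
  ext i
  simp
  ring

lemma eq_northPole_of_apply_zero_eq_one {n : ℕ} {y : Fin (n + 1) → ℝ} (hy : y ⬝ᵥ y = 1)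
    (h0 : y 0 = 1) : y = northPole (n + 1) := by
  have hd : (y - northPole (n + 1)) ⬝ᵥ (y - northPole (n + 1)) = 0 := by
    rw [sub_dotProduct, northPole_dotProduct, dotProduct_sub, hy,
      dotProduct_comm y, northPole_dotProduct, Pi.sub_apply, h0]
    simp [northPole]
  exact sub_eq_zero.1 (dotProduct_self_eq_zero.1 hd)

lemma poleReflection_mulVec_northPole {n : ℕ} {y : Fin (n + 1) → ℝ} (hy : y ⬝ᵥ y = 1) :
    poleReflection y *ᵥ northPole (n + 1) = y := by
  rw [poleReflection_mulVec, dotProduct_comm y, northPole_dotProduct]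
  have h1 : northPole (n + 1) 0 = 1 := by simp [northPole]
  rw [h1]
  by_cases h0 : y 0 = 1
  · rw [eq_northPole_of_apply_zero_eq_one hy h0]
    simp
  · rw [inv_mul_cancel₀ (sub_ne_zero.2 (Ne.symm h0))]
    simp

lemma poleReflection_mul_self {n : ℕ} {y : Fin (n + 1) → ℝ} (hy : y ⬝ᵥ y = 1) :
    poleReflection y * poleReflection y = 1 := by
  refine ext_of_mulVec_single fun i => ?_
  rw [← mulVec_mulVec, one_mulVec]
  generalize (Pi.single i 1 : Fin (n + 1) → ℝ) = v
  have h1 : northPole (n + 1) 0 = 1 := by simp [northPole]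
  rw [poleReflection_mulVec y v, poleReflection_mulVec]
  by_cases h0 : y 0 = 1
  · simp [h0]
  · have h2 : 1 - y 0 ≠ 0 := sub_ne_zero.2 (Ne.symm h0)
    rw [dotProduct_sub, dotProduct_smul, dotProduct_sub, hy, dotProduct_comm y (northPole _),
      northPole_dotProduct]
    ext i
    simp only [Pi.sub_apply, Pi.smul_apply, smul_eq_mul, h1]
    field_simp
    ring

/-- `poleReflection y` as an element of the orthogonal group. -/
noncomputable def poleReflectionUnit {n : ℕ} (y : Fin (n + 1) → ℝ) (hy : y ⬝ᵥ y = 1) :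
    orthogonalGroup (Fin (n + 1)) ℝ :=
  ⟨poleReflection y, (mem_orthogonalGroup_iff _ _).2 <| by
    rw [transpose_poleReflection, poleReflection_mul_self hy]⟩

/-- Every `g` is the product of the reflection taking the north pole to its first column with an
element of the stabilizer of the north pole. -/
lemma exists_eq_poleReflectionUnit_mul {n : ℕ} (g : orthogonalGroup (Fin (n + 1)) ℝ)
    (y : Fin (n + 1) → ℝ) (hy : y ⬝ᵥ y = 1)
    (hg : (g : Matrix (Fin (n + 1)) (Fin (n + 1)) ℝ) *ᵥ northPole (n + 1) = y) :
    ∃ k, g = poleReflectionUnit y hy * stabilizerEmb k := by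
  have hself : poleReflectionUnit y hy * poleReflectionUnit y hy = 1 :=
    Subtype.ext (poleReflection_mul_self hy)
  obtain ⟨k, hk⟩ := exists_eq_stabilizerEmb (poleReflectionUnit y hy * g) <| by
    change (poleReflection y * (g : Matrix (Fin (n + 1)) (Fin (n + 1)) ℝ)) *ᵥ _ = _
    rw [← mulVec_mulVec, hg]
    conv_lhs => enter [2]; rw [← poleReflection_mulVec_northPole hy]
    rw [mulVec_mulVec, poleReflection_mul_self hy, one_mulVec]
  exact ⟨k, by rw [← hk, ← mul_assoc, hself, one_mul]⟩

/-- The orthogonal group acts transitively on every sphere. -/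
lemma exists_mulVec_northPole_eq_smul {n : ℕ} (z : Fin (n + 1) → ℝ) :
    ∃ k : orthogonalGroup (Fin (n + 1)) ℝ,
      z = √(z ⬝ᵥ z) • ((k : Matrix (Fin (n + 1)) (Fin (n + 1)) ℝ) *ᵥ northPole (n + 1)) := by
  by_cases hz : z = 0
  · exact ⟨1, by simp [hz]⟩
  · have hpos : 0 < z ⬝ᵥ z :=
      lt_of_le_of_ne (Finset.sum_nonneg fun i _ => mul_self_nonneg (z i))
        (fun h => hz (dotProduct_self_eq_zero.1 h.symm))
    have hs : √(z ⬝ᵥ z) ≠ 0 := (Real.sqrt_pos.2 hpos).ne'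
    have hy : ((√(z ⬝ᵥ z))⁻¹ • z) ⬝ᵥ ((√(z ⬝ᵥ z))⁻¹ • z) = 1 := by
      rw [smul_dotProduct, dotProduct_smul, smul_eq_mul, smul_eq_mul, ← mul_assoc, ← mul_inv,
        Real.mul_self_sqrt hpos.le, inv_mul_cancel₀ hpos.ne']
    refine ⟨poleReflectionUnit _ hy, ?_⟩
    change z = _ • (poleReflection _ *ᵥ _)
    rw [poleReflection_mulVec_northPole hy, smul_smul, mul_inv_cancel₀ hs, one_smul]

/-- The corner entries of the first three powers of `poleReflection y * diag(1, A)`, where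
`y = (t, z)`, are functions of `t` and of the quadratic forms `z'Az` and `z'A²z`. -/
lemma corner_pow_poleReflection_mul {n : ℕ} (t : ℝ) (z : Fin n → ℝ)
    (hy : vecCons t z ⬝ᵥ vecCons t z = 1) (A : Matrix (Fin n) (Fin n) ℝ) :
    let M := poleReflection (vecCons t z) * blockOne A
    let q := z ⬝ᵥ (A *ᵥ z)
    M 0 0 = t ∧ (M ^ 2) 0 0 = t ^ 2 + q ∧
      (M ^ 3) 0 0 = t ^ 3 + 2 * t * q + z ⬝ᵥ ((A ^ 2) *ᵥ z) - (1 - t)⁻¹ * q ^ 2 := by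
  intro M q
  have hcol : M *ᵥ northPole (n + 1) = vecCons t z := by
    rw [← mulVec_mulVec]
    conv_lhs => enter [2]; rw [northPole_succ, blockOne_mulVec, mulVec_zero, ← northPole_succ]
    exact poleReflection_mulVec_northPole hy
  have hrow : northPole (n + 1) ᵥ* M = vecCons t (Aᵀ *ᵥ z) := by
    rw [← mulVec_transpose, transpose_mul, transpose_poleReflection, transpose_blockOne,
      ← mulVec_mulVec, poleReflection_mulVec_northPole hy, blockOne_mulVec]
  have hcol2 : M *ᵥ vecCons t z
      = vecCons (t ^ 2 + q) (t • z + A *ᵥ z - ((1 - t)⁻¹ * q) • z) := by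
    rw [← mulVec_mulVec, blockOne_mulVec, poleReflection_mulVec]
    have hdot : vecCons t z ⬝ᵥ vecCons t (A *ᵥ z) = t * t + q := by simp [q]
    rw [hdot]
    -- For `t = 1` the tail `z` vanishes, so the convention `0⁻¹ = 0` does no harm.
    by_cases h0 : t = 1
    · have hz : z = 0 := by
        have : z ⬝ᵥ z = 0 := by simpa [h0] using hy
        exact dotProduct_self_eq_zero.1 this
      simp [h0, hz, q]
    · have h2 : 1 - t ≠ 0 := sub_ne_zero.2 (Ne.symm h0)
      ext i
      refine Fin.cases ?_ (fun i => ?_) i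
      · simp [northPole_succ]
        field_simp
        ring
      · simp [northPole_succ]
        field_simp
        ring
  refine ⟨?_, ?_, ?_⟩
  · have := congrFun hcol 0
    rwa [mulVec_northPole] at this
  · rw [← northPole_dotProduct fun i => (M ^ 2) i 0, ← mulVec_northPole, pow_two, ← mulVec_mulVec,
      hcol, hcol2, northPole_dotProduct, cons_val_zero]
  · rw [← northPole_dotProduct fun i => (M ^ 3) i 0, ← mulVec_northPole, pow_succ', pow_two,
      ← mulVec_mulVec _ M, ← mulVec_mulVec _ M, hcol, hcol2, dotProduct_mulVec, hrow]
    have h1 : (Aᵀ *ᵥ z) ⬝ᵥ z = q := by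
      rw [mulVec_transpose, ← dotProduct_mulVec]
    have h2 : (Aᵀ *ᵥ z) ⬝ᵥ (A *ᵥ z) = z ⬝ᵥ ((A ^ 2) *ᵥ z) := by
      rw [mulVec_transpose, ← dotProduct_mulVec, mulVec_mulVec, pow_two]
    rw [cons_dotProduct_cons, dotProduct_sub, dotProduct_add, dotProduct_smul, dotProduct_smul, h1,
      h2, smul_eq_mul, smul_eq_mul]
    ring

/-! ### Averaging over the orthogonal group -/

/-- The Haar probability measure on `O(n)`. -/
noncomputable def haarProb (n : ℕ) : Measure (orthogonalGroup (Fin n) ℝ) :=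
  Measure.haarMeasure ⊤

instance isHaarMeasure_haarProb (n : ℕ) : (haarProb n).IsHaarMeasure :=
  Measure.isHaarMeasure_haarMeasure _

instance isProbabilityMeasure_haarProb (n : ℕ) : IsProbabilityMeasure (haarProb n) :=
  ⟨Measure.haarMeasure_self⟩

/-- A right translate of the Haar probability measure is again a Haar probability measure, so
uniqueness gives right invariance. -/
instance isMulRightInvariant_haarProb (n : ℕ) : (haarProb n).IsMulRightInvariant where
  map_mul_right_eq_self h := by
    have : IsProbabilityMeasure ((haarProb n).map (· * h)) :=
      Measure.isProbabilityMeasure_map (measurable_mul_const h).aemeasurable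
    exact Measure.isHaarMeasure_eq_of_isProbabilityMeasure _ _

lemma lintegral_haarProb_conj {n : ℕ} (F : orthogonalGroup (Fin n) ℝ → ENNReal)
    (k : orthogonalGroup (Fin n) ℝ) :
    ∫⁻ D, F (k⁻¹ * D * k) ∂haarProb n = ∫⁻ D, F D ∂haarProb n := by
  rw [lintegral_mul_left_eq_self (fun D => F (D * k)) k⁻¹, lintegral_mul_right_eq_self]

/-- Multiplying a Haar distributed matrix by an independent random element of the stabilizer of
the north pole leaves its law unchanged. -/
lemma lintegral_haarProb_mul_stabilizerEmb {n : ℕ}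
    {F : orthogonalGroup (Fin (n + 1)) ℝ → ENNReal} (hF : Measurable F) :
    ∫⁻ g, F g ∂haarProb (n + 1)
      = ∫⁻ g, ∫⁻ D, F (g * stabilizerEmb D) ∂haarProb n ∂haarProb (n + 1) := by
  rw [lintegral_lintegral_swap]
  · simp_rw [lintegral_mul_right_eq_self F, lintegral_const, measure_univ, mul_one]
  · exact (hF.comp (measurable_fst.mul
      (continuous_stabilizerEmb.measurable.comp measurable_snd))).aemeasurable

lemma continuous_northPoleStat (p k : ℕ) : Continuous (northPoleStat p k) :=
  continuous_const.dotProduct ((continuous_subtype_val.pow k).matrix_mulVec continuous_const)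

lemma measurable_northPoleStat (p k : ℕ) : Measurable (northPoleStat p k) :=
  (continuous_northPoleStat p k).measurable

/-- If `z` has length `s` and `k` takes the north pole to the direction of `z`, then
`z'Dⁱz = s² x₀'(k⁻¹Dk)ⁱx₀`. -/
lemma dotProduct_pow_mulVec_eq {n : ℕ} (i : ℕ) (D k : orthogonalGroup (Fin (n + 1)) ℝ) (s : ℝ) :
    (s • ((k : Matrix (Fin (n + 1)) (Fin (n + 1)) ℝ) *ᵥ northPole (n + 1))) ⬝ᵥ
      (((D : Matrix (Fin (n + 1)) (Fin (n + 1)) ℝ) ^ i) *ᵥ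
        (s • ((k : Matrix (Fin (n + 1)) (Fin (n + 1)) ℝ) *ᵥ northPole (n + 1))))
      = s ^ 2 * northPoleStat (n + 1) i (k⁻¹ * D * k) := by
  have hpow : (k⁻¹ * D * k) ^ i = k⁻¹ * D ^ i * k := by
    simpa using conj_pow (i := i) (a := k⁻¹) (b := D)
  rw [northPoleStat, ← SubmonoidClass.coe_pow, ← SubmonoidClass.coe_pow, hpow,
    Submonoid.coe_mul, Submonoid.coe_mul, ← mulVec_mulVec, ← mulVec_mulVec,
    coe_inv_orthogonalGroup, dotProduct_mulVec _ (_ : Matrix _ _ ℝ)ᵀ, vecMul_transpose,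
    mulVec_smul, smul_dotProduct, dotProduct_smul, smul_eq_mul, smul_eq_mul]
  ring

/-- The corner entries of `g`, `g²` and `g³`. -/
def cornerTriple {p : ℕ} (g : orthogonalGroup (Fin p) ℝ) : ℝ × ℝ × ℝ :=
  (northPoleStat p 1 g, northPoleStat p 2 g, northPoleStat p 3 g)

lemma measurable_cornerTriple {p : ℕ} : Measurable (cornerTriple (p := p)) :=
  (measurable_northPoleStat _ 1).prodMk
    ((measurable_northPoleStat _ 2).prodMk (measurable_northPoleStat _ 3))

/-- The corner entries of the first three powers of `g`, in terms of the corner `t` of `g` and the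
corners `a`, `b` of `D`, `D²`, where `D` is the orthogonal matrix of one size less which `g`
induces after removal of a reflection. -/
def cornerStep (t a b : ℝ) : ℝ × ℝ × ℝ :=
  (t, t ^ 2 + (1 - t ^ 2) * a,
    t ^ 3 + 2 * t * (1 - t ^ 2) * a + (1 - t ^ 2) * (b - (1 + t) * a ^ 2))

/-- The recursion in the dimension: if `D` is a Haar distributed element of `O(n + 1)` independent
of the corner of a Haar distributed element of `O(n + 2)`, then the joint law of the corners
of the first three powers of the latter is given by `cornerStep`. -/
lemma lintegral_cornerTriple {n : ℕ} {F : ℝ × ℝ × ℝ → ENNReal} (hF : Measurable F) :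
    ∫⁻ g, F (cornerTriple g) ∂haarProb (n + 2)
      = ∫⁻ g, ∫⁻ D, F (cornerStep (northPoleStat (n + 2) 1 g)
          (northPoleStat (n + 1) 1 D) (northPoleStat (n + 1) 2 D))
        ∂haarProb (n + 1) ∂haarProb (n + 2) := by
  rw [lintegral_haarProb_mul_stabilizerEmb (F := fun g => F (cornerTriple g))
    (hF.comp measurable_cornerTriple)]
  refine lintegral_congr fun g => ?_
  set y : Fin (n + 2) → ℝ := (g : Matrix (Fin (n + 2)) (Fin (n + 2)) ℝ) *ᵥ northPole (n + 2)
    with hgy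
  have hy : y ⬝ᵥ y = 1 := by
    rw [dotProduct_mulVec_orthogonalGroup, northPole_dotProduct]
    simp [northPole]
  obtain ⟨h, hgh⟩ := exists_eq_poleReflectionUnit_mul g y hy rfl
  have ht : northPoleStat (n + 2) 1 g = y 0 := by
    rw [northPoleStat, pow_one, ← hgy, northPole_dotProduct]
  rw [ht]
  clear_value y
  obtain ⟨t, z, rfl⟩ : ∃ t z, y = vecCons t z := ⟨_, _, (cons_head_tail y).symm⟩
  rw [cons_val_zero]
  have hzz : z ⬝ᵥ z = 1 - t ^ 2 := by
    have : t * t + z ⬝ᵥ z = 1 := by simpa using hy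
    linarith
  have hnonneg : 0 ≤ z ⬝ᵥ z := Finset.sum_nonneg fun i _ => mul_self_nonneg (z i)
  obtain ⟨k, hk⟩ := exists_mulVec_northPole_eq_smul z
  -- Left invariance removes the stabilizer part `h` of `g`, and conjugation by `k`
  -- replaces the direction of `z` by the north pole.
  simp_rw [hgh, mul_assoc, ← stabilizerEmb_mul]
  rw [lintegral_mul_left_eq_self (fun D => F (cornerTriple
      (poleReflectionUnit _ hy * stabilizerEmb D))) h,
    ← lintegral_haarProb_conj (fun D => F (cornerStep t (northPoleStat (n + 1) 1 D)
      (northPoleStat (n + 1) 2 D))) k]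
  refine lintegral_congr fun D => congrArg F ?_
  have hsq : √(z ⬝ᵥ z) ^ 2 = 1 - t ^ 2 := by rw [Real.sq_sqrt hnonneg, hzz]
  have hq (i : ℕ) : z ⬝ᵥ (((D : Matrix (Fin (n + 1)) (Fin (n + 1)) ℝ) ^ i) *ᵥ z)
      = (1 - t ^ 2) * northPoleStat (n + 1) i (k⁻¹ * D * k) := by
    rw [← hsq, ← dotProduct_pow_mulVec_eq, ← hk]
  obtain ⟨h1, h2, h3⟩ := corner_pow_poleReflection_mul t z hy D
  have hq1 := hq 1
  rw [pow_one] at hq1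
  rw [hq1] at h2 h3
  rw [hq 2] at h3
  have hM : ((poleReflectionUnit _ hy * stabilizerEmb D : orthogonalGroup (Fin (n + 2)) ℝ) :
      Matrix (Fin (n + 2)) (Fin (n + 2)) ℝ) = poleReflection (vecCons t z) * blockOne D := rfl
  have hfactor : (1 - t)⁻¹ * (1 - t ^ 2) ^ 2 = (1 - t ^ 2) * (1 + t) := by
    by_cases h0 : t = 1
    -- At `t = 1` both sides vanish, the inverse being zero by convention.
    · simp [h0]
    · field_simp [sub_ne_zero.2 (Ne.symm h0)]
      ring
  simp only [cornerTriple, cornerStep, northPoleStat_succ (n := n + 1), hM, pow_one, h1, h2, h3]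
  refine Prod.ext rfl (Prod.ext rfl ?_)
  linear_combination (-(northPoleStat (n + 1) 1 (k⁻¹ * D * k)) ^ 2) * hfactor

/-! ### The law of the corner entry -/

/-- The elements of `O(1)` are `±1`, and multiplication by `-1` preserves the Haar measure. -/
lemma lintegral_northPoleStat_one_orthogonalGroup_one {F : ℝ → ENNReal} (hF : Measurable F) :
    ∫⁻ g, F (northPoleStat 1 1 g) ∂haarProb 1 = ∫⁻ x, F x ∂coordLaw 1 := by
  have hFm : Measurable fun g : orthogonalGroup (Fin 1) ℝ => F (northPoleStat 1 1 g) :=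
    hF.comp (measurable_northPoleStat 1 1)
  have hneg (g : orthogonalGroup (Fin 1) ℝ) :
      northPoleStat 1 1 (-1 * g) = -northPoleStat 1 1 g := by
    rw [northPoleStat_succ (n := 0), northPoleStat_succ (n := 0), pow_one, pow_one, neg_one_mul]
    rfl
  have hpm (g : orthogonalGroup (Fin 1) ℝ) :
      F (northPoleStat 1 1 g) + F (-northPoleStat 1 1 g) = F 1 + F (-1) := by
    have h := congrFun (congrFun (mul_transpose_self_orthogonalGroup g) 0) 0
    rw [mul_apply, Fin.sum_univ_one, transpose_apply, one_apply_eq] at h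
    rw [northPoleStat_succ (n := 0), pow_one]
    rcases mul_self_eq_one_iff.1 h with h | h
    · rw [h]
    · rw [h, neg_neg, add_comm]
  have hsum : ∫⁻ g, F (northPoleStat 1 1 g) ∂haarProb 1 + ∫⁻ g, F (northPoleStat 1 1 g) ∂haarProb 1
      = F 1 + F (-1) := by
    conv_lhs => enter [2]; rw [← lintegral_mul_left_eq_self _ (-1 : orthogonalGroup (Fin 1) ℝ)]
    rw [← lintegral_add_left hFm]
    simp_rw [hneg, hpm, lintegral_const, measure_univ, mul_one]
  rw [coordLaw, if_pos rfl, lintegral_smul_measure, lintegral_add_measure, lintegral_dirac' _ hF,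
    lintegral_dirac' _ hF, ← hsum, ← two_mul, smul_eq_mul, ← mul_assoc,
    ENNReal.inv_mul_cancel two_ne_zero ENNReal.ofNat_ne_top, one_mul]

lemma lintegral_comp_mulVec_orthogonalGroup {n : ℕ} (g : orthogonalGroup (Fin n) ℝ)
    {G : (Fin n → ℝ) → ENNReal} (hG : Measurable G) :
    ∫⁻ x, G ((g : Matrix (Fin n) (Fin n) ℝ) *ᵥ x) = ∫⁻ x, G x := by
  have hdet : |(g : Matrix (Fin n) (Fin n) ℝ).det| = 1 := by
    have h := congrArg det (mul_transpose_self_orthogonalGroup g)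
    rw [det_mul, det_transpose, det_one] at h
    exact (abs_eq zero_le_one).2 (mul_self_eq_one_iff.1 h)
  have hdet0 : (g : Matrix (Fin n) (Fin n) ℝ).det ≠ 0 := by
    intro h
    simp [h] at hdet
  have hmap := Real.map_matrix_volume_pi_eq_smul_volume_pi hdet0
  rw [abs_inv, hdet, inv_one, ENNReal.ofReal_one, one_smul] at hmap
  have hcont : Continuous (toLin' (g : Matrix (Fin n) (Fin n) ℝ)) :=
    LinearMap.continuous_of_finiteDimensional _
  conv_rhs => rw [← hmap, lintegral_map hG hcont.measurable]
  simp_rw [toLin'_apply]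

/-- The direction of a vector with a rotation invariant density is distributed as the first column
of a Haar distributed matrix: rotate the vector by an independent such matrix. -/
lemma lintegral_radial_mul {n : ℕ} {w F : ℝ → ENNReal} (hw : Measurable w) (hF : Measurable F) :
    ∫⁻ x : Fin (n + 1) → ℝ, w (x ⬝ᵥ x) * F (x 0 / √(x ⬝ᵥ x))
      = (∫⁻ x : Fin (n + 1) → ℝ, w (x ⬝ᵥ x))
        * ∫⁻ g, F (northPoleStat (n + 1) 1 g) ∂haarProb (n + 1) := by
  have hdot : Measurable fun x : Fin (n + 1) → ℝ => x ⬝ᵥ x :=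
    (continuous_id.dotProduct continuous_id).measurable
  have happ : Measurable fun q : orthogonalGroup (Fin (n + 1)) ℝ × (Fin (n + 1) → ℝ) =>
      ((q.1 : Matrix (Fin (n + 1)) (Fin (n + 1)) ℝ) *ᵥ q.2) 0 := by
    have hcont : Continuous fun q : orthogonalGroup (Fin (n + 1)) ℝ × (Fin (n + 1) → ℝ) =>
        (q.1 : Matrix (Fin (n + 1)) (Fin (n + 1)) ℝ) *ᵥ q.2 :=
      (continuous_subtype_val.comp continuous_fst).matrix_mulVec continuous_snd
    exact ((continuous_apply 0).comp hcont).measurable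
  have hrot (g : orthogonalGroup (Fin (n + 1)) ℝ) :
      ∫⁻ x : Fin (n + 1) → ℝ, w (x ⬝ᵥ x) * F (x 0 / √(x ⬝ᵥ x))
        = ∫⁻ x : Fin (n + 1) → ℝ, w (x ⬝ᵥ x)
          * F (((g : Matrix (Fin (n + 1)) (Fin (n + 1)) ℝ) *ᵥ x) 0 / √(x ⬝ᵥ x)) := by
    rw [← lintegral_comp_mulVec_orthogonalGroup g]
    · simp_rw [dotProduct_mulVec_orthogonalGroup]
    · exact (hw.comp hdot).mul (hF.comp ((measurable_pi_apply 0).div hdot.sqrt))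
  calc ∫⁻ x : Fin (n + 1) → ℝ, w (x ⬝ᵥ x) * F (x 0 / √(x ⬝ᵥ x))
      = ∫⁻ g : orthogonalGroup (Fin (n + 1)) ℝ, ∫⁻ x : Fin (n + 1) → ℝ, w (x ⬝ᵥ x)
          * F (((g : Matrix (Fin (n + 1)) (Fin (n + 1)) ℝ) *ᵥ x) 0 / √(x ⬝ᵥ x))
          ∂volume ∂haarProb (n + 1) := by
        simp_rw [← hrot, lintegral_const, measure_univ, mul_one]
    _ = ∫⁻ x : Fin (n + 1) → ℝ, ∫⁻ g : orthogonalGroup (Fin (n + 1)) ℝ, w (x ⬝ᵥ x)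
          * F (((g : Matrix (Fin (n + 1)) (Fin (n + 1)) ℝ) *ᵥ x) 0 / √(x ⬝ᵥ x))
          ∂haarProb (n + 1) :=
        lintegral_lintegral_swap ((hw.comp (hdot.comp measurable_snd)).mul
          (hF.comp (happ.div (hdot.comp measurable_snd).sqrt))).aemeasurable
    _ = ∫⁻ x : Fin (n + 1) → ℝ, w (x ⬝ᵥ x)
          * ∫⁻ g, F (northPoleStat (n + 1) 1 g) ∂haarProb (n + 1) := by
        have hne : ∀ᵐ x : Fin (n + 1) → ℝ, x ≠ 0 := by
          simp [ae_iff]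
        refine lintegral_congr_ae (hne.mono fun x hx => ?_)
        dsimp only
        rw [lintegral_const_mul]
        swap
        · exact hF.comp ((happ.comp (measurable_id.prodMk measurable_const)).div measurable_const)
        congr 1
        obtain ⟨k, hk⟩ := exists_mulVec_northPole_eq_smul x
        have hs : √(x ⬝ᵥ x) ≠ 0 := by
          intro h
          rw [h, zero_smul] at hk
          exact hx hk
        rw [← lintegral_mul_right_eq_self (fun g => F (northPoleStat (n + 1) 1 g)) k]
        refine lintegral_congr fun g => congrArg F ?_
        nth_rewrite 1 [hk]
        rw [northPoleStat, pow_one, northPole_dotProduct, Submonoid.coe_mul, ← mulVec_mulVec,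
          mulVec_smul, Pi.smul_apply, smul_eq_mul, mul_div_cancel_left₀ _ hs]
    _ = _ := lintegral_mul_const _ (hw.comp hdot)

/-- The substitution `a = r t / √(1 - t²)`, under which `t = a / √(a² + r²)`. -/
lemma lintegral_eq_lintegral_Ioo_slope {r : ℝ} (hr : 0 < r) (w F : ℝ → ENNReal) :
    ∫⁻ a : ℝ, w (a ^ 2 + r ^ 2) * F (a / √(a ^ 2 + r ^ 2))
      = ∫⁻ t in Set.Ioo (-1 : ℝ) 1, ENNReal.ofReal (r / ((1 - t ^ 2) * √(1 - t ^ 2)))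
          * (w (r ^ 2 / (1 - t ^ 2)) * F t) := by
  set f : ℝ → ℝ := fun t => r * t / √(1 - t ^ 2) with hf
  have hpos {t : ℝ} (ht : t ∈ Set.Ioo (-1 : ℝ) 1) : 0 < 1 - t ^ 2 := by
    nlinarith [ht.1, ht.2]
  have hfsq {t : ℝ} (ht : t ∈ Set.Ioo (-1 : ℝ) 1) : f t ^ 2 + r ^ 2 = r ^ 2 / (1 - t ^ 2) := by
    have := (hpos ht).ne'
    rw [hf]
    simp only [div_pow, mul_pow, Real.sq_sqrt (hpos ht).le]
    field_simp
    ring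
  have hfinv {t : ℝ} (ht : t ∈ Set.Ioo (-1 : ℝ) 1) : f t / √(f t ^ 2 + r ^ 2) = t := by
    have := (Real.sqrt_pos.2 (hpos ht)).ne'
    rw [hfsq ht, Real.sqrt_div (sq_nonneg r), Real.sqrt_sq hr.le, hf]
    field_simp
  have hderiv (t : ℝ) (ht : t ∈ Set.Ioo (-1 : ℝ) 1) :
      HasDerivWithinAt f (r / ((1 - t ^ 2) * √(1 - t ^ 2))) (Set.Ioo (-1 : ℝ) 1) t := by
    have hs := (Real.sqrt_pos.2 (hpos ht)).ne'
    have h0 := (hpos ht).ne'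
    have h1 : HasDerivAt (fun t : ℝ => 1 - t ^ 2) (-(2 * t)) t := by
      simpa using (hasDerivAt_pow 2 t).const_sub 1
    have h2 := (((hasDerivAt_id t).const_mul r).div (h1.sqrt h0) hs).hasDerivWithinAt
      (s := Set.Ioo (-1 : ℝ) 1)
    refine h2.congr_deriv ?_
    have h3 : √(1 - t ^ 2) ^ 2 = 1 - t ^ 2 := Real.sq_sqrt (hpos ht).le
    simp only [id]
    field_simp
    rw [h3]
    ring
  have himage : f '' Set.Ioo (-1 : ℝ) 1 = Set.univ := by
    refine Set.eq_univ_of_forall fun a => ⟨a / √(a ^ 2 + r ^ 2), ?_, ?_⟩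
    · have hlt : |a| < √(a ^ 2 + r ^ 2) := Real.lt_sqrt_of_sq_lt (by rw [sq_abs]; nlinarith)
      have h0 : 0 < √(a ^ 2 + r ^ 2) := (abs_nonneg a).trans_lt hlt
      rw [Set.mem_Ioo, ← abs_lt, abs_div, abs_of_pos h0, div_lt_one h0]
      exact hlt
    · have h0 : 0 < a ^ 2 + r ^ 2 := by positivity
      have hs := Real.sqrt_pos.2 h0
      have h1 : 1 - (a / √(a ^ 2 + r ^ 2)) ^ 2 = r ^ 2 / (a ^ 2 + r ^ 2) := by
        rw [div_pow, Real.sq_sqrt h0.le]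
        field_simp
        ring
      rw [hf]
      simp only
      rw [h1, Real.sqrt_div (sq_nonneg r), Real.sqrt_sq hr.le]
      field_simp
  have hinj : Set.InjOn f (Set.Ioo (-1 : ℝ) 1) := fun s hs t ht hst => by
    rw [← hfinv hs, ← hfinv ht, hst]
  rw [← setLIntegral_univ, ← himage,
    lintegral_image_eq_lintegral_abs_deriv_mul measurableSet_Ioo hderiv hinj]
  refine setLIntegral_congr_fun measurableSet_Ioo fun t ht => ?_
  have := hpos ht
  rw [hfinv ht, hfsq ht, abs_of_nonneg (by positivity)]

/-- The dilation `z ↦ z / √c`, which extracts the power of `1 - t²` from the density. -/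
lemma lintegral_sqrt_mul_radial_div {n : ℕ} (w : ℝ → ENNReal) {c : ℝ} (hc : 0 < c) :
    ∫⁻ z : Fin n → ℝ, ENNReal.ofReal √(z ⬝ᵥ z) * w (z ⬝ᵥ z / c)
      = ENNReal.ofReal (√c ^ (n + 1))
        * ∫⁻ z : Fin n → ℝ, ENNReal.ofReal √(z ⬝ᵥ z) * w (z ⬝ᵥ z) := by
  have hs := Real.sqrt_pos.2 hc
  have hmap := Measure.map_addHaar_smul (volume : Measure (Fin n → ℝ)) (inv_ne_zero hs.ne')
  rw [Module.finrank_fin_fun, inv_pow, inv_inv, abs_of_pos (pow_pos hs n)] at hmap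
  have hemb : MeasurableEmbedding fun z : Fin n → ℝ => (√c)⁻¹ • z :=
    (Homeomorph.smulOfNeZero _ (inv_ne_zero hs.ne')).measurableEmbedding
  have h := hemb.lintegral_map (μ := volume)
    (fun z : Fin n → ℝ => ENNReal.ofReal √(z ⬝ᵥ z) * w (z ⬝ᵥ z))
  rw [hmap, lintegral_smul_measure, smul_eq_mul] at h
  rw [pow_succ', ENNReal.ofReal_mul hs.le, mul_assoc, h,
    ← lintegral_const_mul' _ _ ENNReal.ofReal_ne_top]
  refine lintegral_congr fun z => ?_
  have hz : ((√c)⁻¹ • z) ⬝ᵥ ((√c)⁻¹ • z) = z ⬝ᵥ z / c := by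
    rw [smul_dotProduct, dotProduct_smul, smul_eq_mul, smul_eq_mul, ← mul_assoc, ← mul_inv,
      Real.mul_self_sqrt hc.le, div_eq_inv_mul]
  rw [hz, ← mul_assoc, ← ENNReal.ofReal_mul hs.le, ← Real.sqrt_mul hc.le,
    mul_div_cancel₀ _ hc.ne']

lemma lintegral_eq_lintegral_vecCons {n : ℕ} {G : (Fin (n + 1) → ℝ) → ENNReal}
    (hG : Measurable G) :
    ∫⁻ x, G x = ∫⁻ z : Fin n → ℝ, ∫⁻ a : ℝ, G (vecCons a z) := by
  have hmp := (volume_preserving_piFinSuccAbove (fun _ : Fin (n + 1) => ℝ) 0).symm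
  rw [← hmp.lintegral_comp hG, Measure.volume_eq_prod,
    lintegral_prod_symm (fun u => G ((MeasurableEquiv.piFinSuccAbove _ 0).symm u))
      (hG.comp hmp.measurable).aemeasurable]
  exact lintegral_congr fun z => lintegral_congr fun a => congrArg G (Fin.insertNth_zero' a z)

/-- Integration of a radial weight times a function of the first coordinate of the direction: the
first coordinate has density proportional to `(1 - t²)^((q - 3) / 2)` in dimension `q`. -/
lemma lintegral_radial_mul_eq_lintegral_Ioo {m : ℕ} {w F : ℝ → ENNReal} (hw : Measurable w)
    (hF : Measurable F) :
    ∫⁻ x : Fin (m + 2) → ℝ, w (x ⬝ᵥ x) * F (x 0 / √(x ⬝ᵥ x))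
      = (∫⁻ z : Fin (m + 1) → ℝ, ENNReal.ofReal √(z ⬝ᵥ z) * w (z ⬝ᵥ z))
        * ∫⁻ t in Set.Ioo (-1 : ℝ) 1,
            ENNReal.ofReal ((1 - t ^ 2) ^ ((((m + 2 : ℕ) : ℝ) - 3) / 2)) * F t := by
  have hdot (n : ℕ) : Measurable fun x : Fin n → ℝ => x ⬝ᵥ x :=
    (continuous_id.dotProduct continuous_id).measurable
  have hsub : Measurable fun t : ℝ => 1 - t ^ 2 := by fun_prop
  rw [lintegral_eq_lintegral_vecCons (G := fun x => w (x ⬝ᵥ x) * F (x 0 / √(x ⬝ᵥ x)))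
    ((hw.comp (hdot _)).mul (hF.comp ((measurable_pi_apply 0).div (hdot _).sqrt)))]
  have hslope : ∀ᵐ z : Fin (m + 1) → ℝ,
      ∫⁻ a : ℝ, w (vecCons a z ⬝ᵥ vecCons a z)
          * F (vecCons a z 0 / √(vecCons a z ⬝ᵥ vecCons a z))
        = ∫⁻ t in Set.Ioo (-1 : ℝ) 1,
            ENNReal.ofReal (√(z ⬝ᵥ z) / ((1 - t ^ 2) * √(1 - t ^ 2)))
              * (w (z ⬝ᵥ z / (1 - t ^ 2)) * F t) := by
    have hne : ∀ᵐ z : Fin (m + 1) → ℝ, z ≠ 0 := by simp [ae_iff]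
    refine hne.mono fun z hz => ?_
    have hnonneg : 0 ≤ z ⬝ᵥ z := Finset.sum_nonneg fun i _ => mul_self_nonneg (z i)
    have hpos : 0 < z ⬝ᵥ z :=
      lt_of_le_of_ne hnonneg fun h => hz (dotProduct_self_eq_zero.1 h.symm)
    have h := lintegral_eq_lintegral_Ioo_slope (Real.sqrt_pos.2 hpos) w F
    rw [Real.sq_sqrt hnonneg] at h
    rw [← h]
    refine lintegral_congr fun a => ?_
    rw [cons_dotProduct_cons, cons_val_zero, pow_two]
  rw [lintegral_congr_ae hslope, lintegral_lintegral_swap, ← lintegral_const_mul]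
  · refine setLIntegral_congr_fun measurableSet_Ioo fun t ht => ?_
    have hpos : 0 < 1 - t ^ 2 := by nlinarith [ht.1, ht.2]
    have hs := Real.sqrt_pos.2 hpos
    have hexp : ((1 - t ^ 2) * √(1 - t ^ 2))⁻¹ * √(1 - t ^ 2) ^ (m + 1 + 1)
        = (1 - t ^ 2) ^ ((((m + 2 : ℕ) : ℝ) - 3) / 2) := by
      generalize 1 - t ^ 2 = u at hpos
      rw [Real.sqrt_eq_rpow, ← Real.rpow_natCast, ← Real.rpow_mul hpos.le]
      nth_rewrite 1 [← Real.rpow_one u]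
      rw [← Real.rpow_add hpos, ← Real.rpow_neg hpos.le, ← Real.rpow_add hpos]
      congr 1
      push_cast
      ring
    calc ∫⁻ z : Fin (m + 1) → ℝ, ENNReal.ofReal (√(z ⬝ᵥ z) / ((1 - t ^ 2) * √(1 - t ^ 2)))
              * (w (z ⬝ᵥ z / (1 - t ^ 2)) * F t)
        = ∫⁻ z : Fin (m + 1) → ℝ, ENNReal.ofReal ((1 - t ^ 2) * √(1 - t ^ 2))⁻¹ * F t
            * (ENNReal.ofReal √(z ⬝ᵥ z) * w (z ⬝ᵥ z / (1 - t ^ 2))) := by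
          refine lintegral_congr fun z => ?_
          rw [div_eq_inv_mul, ENNReal.ofReal_mul (by positivity)]
          ring
      _ = ENNReal.ofReal ((1 - t ^ 2) * √(1 - t ^ 2))⁻¹ * F t
            * (ENNReal.ofReal (√(1 - t ^ 2) ^ (m + 1 + 1))
              * ∫⁻ z : Fin (m + 1) → ℝ, ENNReal.ofReal √(z ⬝ᵥ z) * w (z ⬝ᵥ z)) := by
          rw [lintegral_const_mul, lintegral_sqrt_mul_radial_div w hpos]
          exact (hdot _).sqrt.ennreal_ofReal.mul (hw.comp ((hdot _).div_const _))
      _ = _ := by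
          rw [← hexp, ENNReal.ofReal_mul (by positivity)]
          ring
  · exact (hsub.pow_const _).ennreal_ofReal.mul hF
  · refine Measurable.aemeasurable ?_
    have h1 : Measurable fun u : (Fin (m + 1) → ℝ) × ℝ => 1 - u.2 ^ 2 := by fun_prop
    have h2 : Measurable fun u : (Fin (m + 1) → ℝ) × ℝ => u.1 ⬝ᵥ u.1 :=
      (hdot (m + 1)).comp measurable_fst
    exact (h2.sqrt.div (h1.mul h1.sqrt)).ennreal_ofReal.mul
      ((hw.comp (h2.div h1)).mul (hF.comp measurable_snd))

lemma lintegral_coordLaw {q : ℕ} (hq : 2 ≤ q) {F : ℝ → ENNReal} (hF : Measurable F) :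
    ∫⁻ x, F x ∂coordLaw q
      = ENNReal.ofReal
          (Real.Gamma ((q : ℝ) / 2) / (Real.Gamma (1 / 2) * Real.Gamma (((q : ℝ) - 1) / 2)))
        * ∫⁻ t in Set.Ioo (-1 : ℝ) 1, ENNReal.ofReal ((1 - t ^ 2) ^ (((q : ℝ) - 3) / 2)) * F t := by
  have hq' : (2 : ℝ) ≤ q := by exact_mod_cast hq
  have hc : 0 ≤ Real.Gamma ((q : ℝ) / 2)
      / (Real.Gamma (1 / 2) * Real.Gamma (((q : ℝ) - 1) / 2)) :=
    div_nonneg (Real.Gamma_nonneg_of_nonneg (by linarith))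
      (mul_nonneg (Real.Gamma_nonneg_of_nonneg (by norm_num))
        (Real.Gamma_nonneg_of_nonneg (by linarith)))
  have hpow : Measurable fun t : ℝ => (1 - t ^ 2) ^ (((q : ℝ) - 3) / 2) := by fun_prop
  have hdens : Measurable (coordDensity q) := by
    refine Measurable.ite (measurableSet_lt (by fun_prop) measurable_const) ?_ measurable_const
    exact hpow.const_mul _
  rw [coordLaw, if_neg (by omega), lintegral_withDensity_eq_lintegral_mul _ hdens.ennreal_ofReal hF,
    ← lintegral_const_mul' _ _ ENNReal.ofReal_ne_top, ← lintegral_indicator measurableSet_Ioo]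
  refine lintegral_congr fun t => ?_
  by_cases ht : |t| < 1
  · rw [Set.indicator_of_mem (Set.mem_Ioo.2 (abs_lt.1 ht)), Pi.mul_apply, coordDensity, if_pos ht,
      ENNReal.ofReal_mul hc, mul_assoc]
  · rw [Set.indicator_of_notMem (fun h => ht (abs_lt.2 (Set.mem_Ioo.1 h))), Pi.mul_apply,
      coordDensity, if_neg ht, ENNReal.ofReal_zero, zero_mul]

/-- The corner entry of a Haar distributed element of `O(q)` has law `coordLaw q`. The two laws
have proportional densities by the computation for the uniform distribution on the unit ball, so
they agree as soon as both are probability measures. -/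
lemma lintegral_northPoleStat_one_of_two_le {m : ℕ} [IsProbabilityMeasure (coordLaw (m + 2))]
    {F : ℝ → ENNReal} (hF : Measurable F) :
    ∫⁻ g, F (northPoleStat (m + 2) 1 g) ∂haarProb (m + 2) = ∫⁻ x, F x ∂coordLaw (m + 2) := by
  -- The weight `w (x ⬝ᵥ x)` is the indicator function of the open unit ball.
  set w : ℝ → ENNReal := (Set.Iio 1).indicator 1
  have hw : Measurable w := measurable_one.indicator measurableSet_Iio
  have hcont : Continuous fun x : Fin (m + 2) → ℝ => x ⬝ᵥ x :=
    continuous_id.dotProduct continuous_id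
  have hopen : IsOpen {x : Fin (m + 2) → ℝ | x ⬝ᵥ x < 1} := isOpen_lt hcont continuous_const
  set V := ∫⁻ x : Fin (m + 2) → ℝ, w (x ⬝ᵥ x) with hV
  have hVball : V = volume {x : Fin (m + 2) → ℝ | x ⬝ᵥ x < 1} := by
    rw [← lintegral_indicator_one hopen.measurableSet]
    rfl
  have hV0 : V ≠ 0 := by
    rw [hVball]
    exact (hopen.measure_pos volume ⟨0, by simp⟩).ne'
  have hVtop : V ≠ ⊤ := by
    rw [hVball]
    refine ((measure_mono fun x hx => ?_).trans_lt
      (isCompact_closedBall (0 : Fin (m + 2) → ℝ) 1).measure_lt_top).ne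
    rw [mem_closedBall_zero_iff, pi_norm_le_iff_of_nonneg zero_le_one]
    intro i
    have h1 : x i * x i ≤ x ⬝ᵥ x :=
      Finset.single_le_sum (f := fun i => x i * x i) (fun j _ => mul_self_nonneg (x j))
        (Finset.mem_univ i)
    exact abs_le_one_iff_mul_self_le_one.2 (h1.trans (le_of_lt hx))
  have hlaw {F : ℝ → ENNReal} (hF : Measurable F) :=
    (lintegral_radial_mul (n := m + 1) hw hF).symm.trans
      (lintegral_radial_mul_eq_lintegral_Ioo hw hF)
  have hdens {F : ℝ → ENNReal} (hF : Measurable F) :=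
    lintegral_coordLaw (q := m + 2) (by omega) hF
  have hlaw1 := hlaw (F := 1) measurable_one
  have hdens1 := hdens (F := 1) measurable_one
  simp only [Pi.one_apply, lintegral_one, measure_univ, mul_one] at hlaw1 hdens1
  refine (ENNReal.mul_right_inj hV0 hVtop).1 ?_
  rw [hV, hlaw hF, hlaw1, hdens hF]
  conv_lhs => rw [← mul_one (_ * _), hdens1]
  ring

/-! ### The law of the corner of the cube -/

/-- The joint law of the corners of `D` and `D²`. -/
lemma lintegral_northPoleStat_one_two {n : ℕ} {F : ℝ × ℝ → ENNReal} (hF : Measurable F) :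
    ∫⁻ D, F (northPoleStat (n + 2) 1 D, northPoleStat (n + 2) 2 D) ∂haarProb (n + 2)
      = ∫⁻ g, ∫⁻ D, F (northPoleStat (n + 2) 1 g, northPoleStat (n + 2) 1 g ^ 2
            + (1 - northPoleStat (n + 2) 1 g ^ 2) * northPoleStat (n + 1) 1 D)
        ∂haarProb (n + 1) ∂haarProb (n + 2) :=
  lintegral_cornerTriple (F := fun u => F (u.1, u.2.1)) (by fun_prop)

/-- The function of three independent variables which represents the corner of the cube. -/
def cubeCorner (x y z : ℝ) : ℝ :=
  x ^ 3 + 2 * x * (1 - x ^ 2) * y + (1 - x ^ 2) * (-x * y ^ 2 + (1 - y ^ 2) * z)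

lemma measurable_cubeCorner : Measurable fun u : ℝ × ℝ × ℝ => cubeCorner u.1 u.2.1 u.2.2 := by
  unfold cubeCorner
  fun_prop

/-- The corner of the cube in terms of three independent corners, by applying the recursion in
the dimension twice. -/
lemma lintegral_northPoleStat_three {m : ℕ} {F : ℝ → ENNReal} (hF : Measurable F) :
    ∫⁻ g, F (northPoleStat (m + 3) 3 g) ∂haarProb (m + 3)
      = ∫⁻ g₁, ∫⁻ g₂, ∫⁻ g₃, F (cubeCorner (northPoleStat (m + 3) 1 g₁)
          (northPoleStat (m + 2) 1 g₂) (northPoleStat (m + 1) 1 g₃))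
        ∂haarProb (m + 1) ∂haarProb (m + 2) ∂haarProb (m + 3) := by
  refine (lintegral_cornerTriple (n := m + 1) (F := fun u => F u.2.2) (by fun_prop)).trans ?_
  refine lintegral_congr fun g => ?_
  simp only [cornerStep]
  generalize northPoleStat (m + 1 + 2) 1 g = t
  rw [lintegral_northPoleStat_one_two (n := m) (F := fun u => F (t ^ 3
    + 2 * t * (1 - t ^ 2) * u.1 + (1 - t ^ 2) * (u.2 - (1 + t) * u.1 ^ 2))) (by fun_prop)]
  refine lintegral_congr fun g₂ => lintegral_congr fun g₃ => congrArg F ?_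
  simp only [cubeCorner]
  ring

lemma lintegral_northPoleStat_one {n : ℕ} [IsProbabilityMeasure (coordLaw (n + 1))]
    {F : ℝ → ENNReal} (hF : Measurable F) :
    ∫⁻ g, F (northPoleStat (n + 1) 1 g) ∂haarProb (n + 1) = ∫⁻ x, F x ∂coordLaw (n + 1) := by
  cases n with
  | zero => exact lintegral_northPoleStat_one_orthogonalGroup_one hF
  | succ m => exact lintegral_northPoleStat_one_of_two_le hF

lemma lintegral_northPoleStat_three_eq_coordLaw {m : ℕ} [IsProbabilityMeasure (coordLaw (m + 1))]
    [IsProbabilityMeasure (coordLaw (m + 2))] [IsProbabilityMeasure (coordLaw (m + 3))]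
    {F : ℝ → ENNReal} (hF : Measurable F) :
    ∫⁻ g, F (northPoleStat (m + 3) 3 g) ∂haarProb (m + 3)
      = ∫⁻ x, ∫⁻ y, ∫⁻ z, F (cubeCorner x y z)
        ∂coordLaw (m + 1) ∂coordLaw (m + 2) ∂coordLaw (m + 3) := by
  have h3 : Measurable fun u : (ℝ × ℝ) × ℝ => F (cubeCorner u.1.1 u.1.2 u.2) :=
    hF.comp (measurable_cubeCorner.comp (measurable_fst.fst.prodMk
      (measurable_fst.snd.prodMk measurable_snd)))
  have h2 : Measurable fun u : ℝ × ℝ => ∫⁻ z, F (cubeCorner u.1 u.2 z) ∂coordLaw (m + 1) :=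
    h3.lintegral_prod_right'
  have h1 : Measurable fun x : ℝ => ∫⁻ y, ∫⁻ z, F (cubeCorner x y z)
      ∂coordLaw (m + 1) ∂coordLaw (m + 2) := h2.lintegral_prod_right'
  have h3' (x y : ℝ) : Measurable fun z => F (cubeCorner x y z) :=
    h3.comp (measurable_prodMk_left (x := (x, y)))
  have h2' (x : ℝ) : Measurable fun y => ∫⁻ z, F (cubeCorner x y z) ∂coordLaw (m + 1) :=
    h2.comp (measurable_prodMk_left (x := x))
  simp_rw [lintegral_northPoleStat_three hF, ← lintegral_northPoleStat_one h1,
    ← lintegral_northPoleStat_one (h2' _), ← lintegral_northPoleStat_one (h3' _ _)]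

lemma lintegral_comp_of_iIndepFun {Ω' : Type*} [MeasurableSpace Ω'] {P' : Measure Ω'}
    [IsProbabilityMeasure P'] {ξ₁ ξ₂ ξ₃ : Ω' → ℝ} {μ₁ μ₂ μ₃ : Measure ℝ}
    (h₁ : HasLaw ξ₁ μ₁ P') (h₂ : HasLaw ξ₂ μ₂ P') (h₃ : HasLaw ξ₃ μ₃ P')
    (hindep : iIndepFun ![ξ₁, ξ₂, ξ₃] P') {G : ℝ × ℝ × ℝ → ENNReal} (hG : Measurable G) :
    ∫⁻ ω, G (ξ₁ ω, ξ₂ ω, ξ₃ ω) ∂P' = ∫⁻ x, ∫⁻ y, ∫⁻ z, G (x, y, z) ∂μ₃ ∂μ₂ ∂μ₁ := by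
  have hmeas : ∀ i, AEMeasurable (![ξ₁, ξ₂, ξ₃] i) P' := by
    intro i
    fin_cases i
    exacts [h₁.aemeasurable, h₂.aemeasurable, h₃.aemeasurable]
  have h23 : IndepFun ξ₂ ξ₃ P' := hindep.indepFun (i := 1) (j := 2) (by decide)
  have h123 : IndepFun ξ₁ (fun ω => (ξ₂ ω, ξ₃ ω)) P' :=
    (hindep.indepFun_prodMk₀ hmeas 1 2 0 (by decide) (by decide)).symm
  have hm23 := h₂.aemeasurable.prodMk h₃.aemeasurable
  have : IsProbabilityMeasure μ₂ := h₂.isProbabilityMeasure_iff.1 inferInstance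
  have : IsProbabilityMeasure μ₃ := h₃.isProbabilityMeasure_iff.1 inferInstance
  have hmap : P'.map (fun ω => (ξ₁ ω, ξ₂ ω, ξ₃ ω)) = μ₁.prod (μ₂.prod μ₃) := by
    rw [(indepFun_iff_map_prod_eq_prod_map_map h₁.aemeasurable hm23).1 h123,
      (indepFun_iff_map_prod_eq_prod_map_map h₂.aemeasurable h₃.aemeasurable).1 h23,
      h₁.map_eq, h₂.map_eq, h₃.map_eq]
  rw [← lintegral_map' hG.aemeasurable (h₁.aemeasurable.prodMk hm23), hmap,
    lintegral_prod _ hG.aemeasurable]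
  exact lintegral_congr fun x =>
    lintegral_prod _ (hG.comp measurable_prodMk_left).aemeasurable

theorem theorem3p4 (p : ℕ) (hp : 3 ≤ p)
    {Ω : Type*} [MeasurableSpace Ω] (P : Measure Ω) [IsProbabilityMeasure P]
    (Γ : Ω → Matrix.orthogonalGroup (Fin p) ℝ) (hΓ : IsHaarDistributed Γ P)
    {Ω' : Type*} [MeasurableSpace Ω'] (P' : Measure Ω') [IsProbabilityMeasure P']
    (ξ₁ ξ₂ ξ₃ : Ω' → ℝ)
    (h₁ : HasLaw ξ₁ (coordLaw p) P')
    (h₂ : HasLaw ξ₂ (coordLaw (p - 1)) P')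
    (h₃ : HasLaw ξ₃ (coordLaw (p - 2)) P')
    (hindep : iIndepFun ![ξ₁, ξ₂, ξ₃] P') :
    IdentDistrib (fun ω => northPoleStat p 3 (Γ ω))
      (fun ω => ξ₁ ω ^ 3 + 2 * ξ₁ ω * (1 - ξ₁ ω ^ 2) * ξ₂ ω
        + (1 - ξ₁ ω ^ 2) * (-(ξ₁ ω) * ξ₂ ω ^ 2 + (1 - ξ₂ ω ^ 2) * ξ₃ ω)) P P' := by
  obtain ⟨m, rfl⟩ : ∃ m, p = m + 3 := ⟨p - 3, by omega⟩
  change HasLaw ξ₂ (coordLaw (m + 2)) P' at h₂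
  change HasLaw ξ₃ (coordLaw (m + 1)) P' at h₃
  -- That the `coordLaw`s are probability measures fixes the constants in the densities.
  have : IsProbabilityMeasure (coordLaw (m + 3)) := h₁.isProbabilityMeasure_iff.1 inferInstance
  have : IsProbabilityMeasure (coordLaw (m + 2)) := h₂.isProbabilityMeasure_iff.1 inferInstance
  have : IsProbabilityMeasure (coordLaw (m + 1)) := h₃.isProbabilityMeasure_iff.1 inferInstance
  have hHaar : P.map Γ = haarProb (m + 3) := by
    have := hΓ.isHaarMeasure_map
    have := Measure.isProbabilityMeasure_map hΓ.aemeasurable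
    exact Measure.isHaarMeasure_eq_of_isProbabilityMeasure _ _
  have hstat := measurable_northPoleStat (m + 3) 3
  have hleft : AEMeasurable (fun ω => northPoleStat (m + 3) 3 (Γ ω)) P :=
    hstat.comp_aemeasurable hΓ.aemeasurable
  have hright : AEMeasurable (fun ω => cubeCorner (ξ₁ ω) (ξ₂ ω) (ξ₃ ω)) P' :=
    measurable_cubeCorner.comp_aemeasurable
      (h₁.aemeasurable.prodMk (h₂.aemeasurable.prodMk h₃.aemeasurable))
  suffices P.map (fun ω => northPoleStat (m + 3) 3 (Γ ω))
      = P'.map (fun ω => cubeCorner (ξ₁ ω) (ξ₂ ω) (ξ₃ ω)) from ⟨hleft, hright, this⟩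
  refine Measure.ext_of_lintegral _ fun F hF => ?_
  rw [lintegral_map' hF.aemeasurable hleft, lintegral_map' hF.aemeasurable hright,
    ← lintegral_map' (f := fun g => F (northPoleStat (m + 3) 3 g))
      (hF.comp hstat).aemeasurable hΓ.aemeasurable, hHaar]
  exact (lintegral_northPoleStat_three_eq_coordLaw hF).trans
    (lintegral_comp_of_iIndepFun h₁ h₂ h₃ hindep (hF.comp measurable_cubeCorner)).symm
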